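/- Two servers process status updates, each of which needs step 1 followed by step 2. Let $\mu_1,\mu_2>0$, $\rho=\mu_1/\mu_2$ and $\alpha\in\mathbb R$. Under the Parallel Shared Intermediate Update (P-SIU) policy both servers always execute the same step of the same update; as soon as one of them completes step 1, it shares the result and both start step 2 of that update; as soon as one of them completes step 2, the update is delivered to the monitor and both start step 1 of a fresh (age $0$) update. The execution times of the two servers in all the steps are independent, those of step $i$ being exponential with rate $\mu_i$. Let $q(t)\in\{1,2\}$ be the step in progress at time $t$, $x_0(t)$ the age at the monitor, and $x_1(t)$ the age of the update in service: both ages grow at unit rate, the completion of step 1 leaves them unchanged, and the completion of step 2 replaces $(x_0,x_1)$ by $(x_1,0)$. The initial step $q(0)\in\{1,2\}$ and the initial ages $x_0(0),x_1(0)\ge 0$ are arbitrary constants. Then: 1. The system acts like a single server with step rates $2\mu_1$ and $2\mu_2$: the durations of the successive steps are independent, and every duration of a step $i$ is exponential with rate $2\mu_i$. 2. $x_0(t)$ is integrable for every $t\ge 0$, and the average age at the monitor is $$\Delta_{\text{P-SIU}}=\lim_{t\to\infty}\mathbb E[x_0(t)]=\frac1{\mu_2}\Bigl[1+\frac1{2\rho}\Bigl(1+\frac1{1+\rho}\Bigr)\Bigr].$$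 3. The Markov chain on $\{1,2\}$ with transitions $1\to2$ at rate $2\mu_1$ and $2\to1$ at rate $2\mu_2$ has exactly one stationary distribution, namely $\pi_1=\frac1{1+\rho}$, $\pi_2=\frac\rho{1+\rho}$, and $\lim_{t\to\infty}\mathbb P(q(t)=q)=\pi_q$ for $q=1,2$. With $n_{q,i}$ the number of servers that execute step $i$ in state $q$, and $\bar N_i(\rho)=\sum_q\pi_q n_{q,i}$, the power-weighted processor activity is $$\bar N(\rho)=\rho^\alpha\bar N_1(\rho)+\bar N_2(\rho)=\frac{2(\rho^\alpha+\rho)}{1+\rho}.$$ 4. The age balance equations $$2\mu_1(v_{10},v_{11})=\pi_1(1,1)+2\mu_2(v_{21},0),\qquad 2\mu_2(v_{20},v_{21})=\pi_2(1,1)+2\mu_1(v_{10},v_{11})$$ have exactly one solution; it is nonnegative, and $v_{10}+v_{20}=\Delta_{\text{P-SIU}}$. -/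

import Mathlib

open MeasureTheory ProbabilityTheory Filter Topology

/-! Steps of an update are indexed by `Fin 2`: `0` is step 1 and `1` is step 2. The same indices
name the discrete states of the system (which step is being executed) and the two servers. -/

/-! ### Stochastic hybrid systems with unit-rate ages -/

/-- The data of a stochastic hybrid system for age analysis: a finite set `L` of transitions between
the discrete states `Q`, each with a rate and a linear reset map acting on row vectors, `x ↦ x A`. -/
structure AgeSHS (Q L ι : Type) where
  src : L → Q
  dst : L → Q
  rate : L → ℝ
  reset : L → Matrix ι ι ℝ

/-- `π` is a stationary distribution of the continuous-time Markov chain of the discrete state. -/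
def AgeSHS.IsStationary {Q L ι : Type} [Fintype Q] [Fintype L] [DecidableEq Q]
    (H : AgeSHS Q L ι) (π : Q → ℝ) : Prop :=
  (∀ q, 0 ≤ π q) ∧ ∑ q, π q = 1 ∧
    ∀ q, π q * (∑ l, if H.src l = q then H.rate l else 0) =
      ∑ l, if H.dst l = q then H.rate l * π (H.src l) else 0

/-- The age balance equations: for every state `q`,
`v_q * (total rate out of q) = π_q * (1, …, 1) + ∑ rate_l * v_{src l} A_l`, the sum being over the
transitions `l` into `q`. -/
def AgeSHS.AgeBalance {Q L ι : Type} [Fintype L] [Fintype ι] [DecidableEq Q]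
    (H : AgeSHS Q L ι) (π : Q → ℝ) (v : Q → ι → ℝ) : Prop :=
  ∀ q, (∑ l, if H.src l = q then H.rate l else 0) • v q = π q • (1 : ι → ℝ) +
    ∑ l, if H.dst l = q then H.rate l • Matrix.vecMul (v (H.src l)) (H.reset l) else 0

/-- The P-SIU hybrid system with age vector `(x₀, x₁)`. Transition `0`: step 1 to step 2
at rate `2 μ₁` with `x' = (x₀, x₁)`. Transition `1`: step 2 to step 1 at rate `2 μ₂` with
`x' = (x₁, 0)`. -/
def psiuSHS (μ₁ μ₂ : ℝ) : AgeSHS (Fin 2) (Fin 2) (Fin 2) where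
  src := ![0, 1]
  dst := ![1, 0]
  rate := ![2 * μ₁, 2 * μ₂]
  reset := ![!![1, 0; 0, 1], !![0, 0; 1, 0]]

/-! ### Power-weighted processor activity -/

/-- The step executed by server `s` in state `q` under P-SIU: both servers execute step `q`. -/
def psiuServerStep (q : Fin 2) (_s : Fin 2) : Fin 2 := q

/-- The number of servers that execute step `i` in state `q` under P-SIU. -/
def psiuNumWorking (q i : Fin 2) : ℕ := Finset.card {s : Fin 2 | psiuServerStep q s = i}

/-- The average number of servers that execute step `i`, when state `q` has probability `π q` and
`n q i` servers execute step `i` in state `q`. -/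
def avgWorking (π : Fin 2 → ℝ) (n : Fin 2 → Fin 2 → ℕ) (i : Fin 2) : ℝ :=
  ∑ q, π q * (n q i : ℝ)

/-- The power-weighted processor activity: `ρ ^ α` times the average number of servers on step 1,
plus the average number of servers on step 2. -/
noncomputable def pwpa (α ρ : ℝ) (π : Fin 2 → ℝ) (n : Fin 2 → Fin 2 → ℕ) : ℝ :=
  ρ ^ α * avgWorking π n 0 + avgWorking π n 1

/-! ### Sample paths

The system passes through phases `0, 1, 2, …`. In each phase one step of one update is executed;
steps 1 and 2 alternate, starting from `q₀`. -/

/-- The step executed in phase `n`. -/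
def phaseStep (q₀ : Fin 2) : ℕ → Fin 2
  | 0 => q₀
  | n + 1 => phaseStep q₀ n + 1

/-- The effect on the ages `x = (x₀, x₁)` (at the monitor, of the update in service) of completing
a step. Completing step 1 changes no age; completing step 2 delivers the update to the monitor and
starts a fresh update. -/
def completeStep (q : Fin 2) (x : Fin 2 → ℝ) : Fin 2 → ℝ :=
  if q = 0 then x else ![x 1, 0]

/-- The time at which phase `n` starts, when phase `k` lasts `d k`. -/
def phaseStart (d : ℕ → ℝ) (n : ℕ) : ℝ := ∑ k ∈ Finset.range n, d k

/-- The ages at the start of phase `n`, when the ages at time `0` are `a`. -/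
def ageAtPhase (q₀ : Fin 2) (a : Fin 2 → ℝ) (d : ℕ → ℝ) : ℕ → Fin 2 → ℝ
  | 0 => a
  | n + 1 => completeStep (phaseStep q₀ n) (fun j => ageAtPhase q₀ a d n j + d n)

/-- The index of the phase in progress at time `t`. -/
noncomputable def phaseAt (d : ℕ → ℝ) (t : ℝ) : ℕ := sSup {n : ℕ | phaseStart d n ≤ t}

/-- The step in progress at time `t`. -/
noncomputable def stateAt (q₀ : Fin 2) (d : ℕ → ℝ) (t : ℝ) : Fin 2 := phaseStep q₀ (phaseAt d t)

/-- The ages `(x₀(t), x₁(t))` at time `t`; within a phase they grow at unit rate. -/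
noncomputable def agesAt (q₀ : Fin 2) (a : Fin 2 → ℝ) (d : ℕ → ℝ) (t : ℝ) (j : Fin 2) : ℝ :=
  ageAtPhase q₀ a d (phaseAt d t) j + (t - phaseStart d (phaseAt d t))

/-! ### P-SIU -/

/-- `T n s` is the time that server `s`, left alone, would need for the step that both servers
start at the beginning of phase `n`. All these times are independent, and those of step `i` are
exponential with rate `μᵢ`. -/
structure IsPSIUExecutionTimes {Ω : Type*} [MeasurableSpace Ω] (P : Measure Ω) (μ₁ μ₂ : ℝ)
    (q₀ : Fin 2) (T : ℕ → Fin 2 → Ω → ℝ) : Prop where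
  measurable : ∀ n s, Measurable (T n s)
  indep : iIndepFun (fun p : ℕ × Fin 2 => T p.1 p.2) P
  law : ∀ n s, HasLaw (T n s) (expMeasure (![μ₁, μ₂] (phaseStep q₀ n))) P

/-- Under P-SIU a phase ends as soon as one of the two servers completes the step: its result is
shared, and both servers move on together. -/
def psiuDuration {Ω : Type*} (T : ℕ → Fin 2 → Ω → ℝ) (ω : Ω) (n : ℕ) : ℝ :=
  min (T n 0 ω) (T n 1 ω)


/-! A phase of P-SIU lasts for the minimum of two independent exponential times of equal rates `μᵢ`,
which is exponential with rate `2 μᵢ`; so the system is an alternating sequence of independent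
exponential phases. If `F q τ x` solves the backward equation of such a system, then, with a fixed
horizon `t`, its value at the successive phase changes, stopped when the time runs out, is a bounded
martingale. Hence `F q₀ t a` is the expectation of `F q(t) 0 x(t)`, and each limit in the theorem
follows from an explicit solution.

With terminal value `1_{q = k}` the solution is the two-state transition function. With terminal
value `x₀` it is affine in the ages: the coefficients of `x₀` and `x₁` are the probabilities of no
delivery and of exactly one delivery, which vanish in the limit. The remaining term integrates the
probability of at most one delivery against the law of the step in progress; in the limit it is the
stationary mean of the time to the second delivery. -/
/-! ### Exponential laws -/

lemma expMeasure_real_Ioi {r : ℝ} (hr : 0 < r) (x : ℝ) :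
    (expMeasure r).real (Set.Ioi x) = Real.exp (-(r * max x 0)) := by
  have := isProbabilityMeasure_expMeasure hr
  rw [← Set.compl_Iic, probReal_compl_eq_one_sub measurableSet_Iic, ← cdf_eq_real,
    cdf_expMeasure_eq hr]
  split_ifs with hx
  · rw [max_eq_left hx, sub_sub_cancel]
  · rw [max_eq_right (not_le.1 hx).le, mul_zero, neg_zero, Real.exp_zero, sub_zero]

lemma integral_expMeasure {r : ℝ} (hr : 0 < r) (f : ℝ → ℝ) :
    ∫ x, f x ∂expMeasure r = ∫ x in Set.Ioi 0, r * Real.exp (-(r * x)) * f x := by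
  change ∫ x, f x ∂volume.withDensity (exponentialPDF r) = _
  rw [integral_withDensity_eq_integral_toReal_smul (f := exponentialPDF r)
    (measurable_exponentialPDFReal r).ennreal_ofReal (by simp [exponentialPDF]),
    ← integral_Ici_eq_integral_Ioi, ← integral_indicator measurableSet_Ici]
  congr 1 with x
  by_cases hx : 0 ≤ x
  · have : 0 ≤ r * Real.exp (-(r * x)) := by positivity
    simp [hx, exponentialPDF_eq, ENNReal.toReal_ofReal this]
  · simp [hx, exponentialPDF_eq]

section

variable {Ω : Type*} [MeasurableSpace Ω] {P : Measure Ω} {r s : ℝ} {X Y : Ω → ℝ}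

lemma ae_pos_of_hasLaw_expMeasure (hr : 0 < r) (hX : HasLaw X (expMeasure r) P) :
    ∀ᵐ ω ∂P, 0 < X ω := by
  have := isProbabilityMeasure_expMeasure hr
  rw [hX.ae_iff (p := fun x => 0 < x) measurableSet_Ioi.mem]
  refine (mem_ae_iff_prob_eq_one (s := Set.Ioi 0) measurableSet_Ioi).2 ?_
  rw [← ofReal_measureReal, expMeasure_real_Ioi hr]
  simp

lemma hasLaw_min_expMeasure [IsProbabilityMeasure P] (hr : 0 < r) (hs : 0 < s)
    (hX : HasLaw X (expMeasure r) P) (hY : HasLaw Y (expMeasure s) P) (hXY : IndepFun X Y P) :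
    HasLaw (fun ω => min (X ω) (Y ω)) (expMeasure (r + s)) P := by
  have hm : AEMeasurable (fun ω => min (X ω) (Y ω)) P := hX.aemeasurable.min hY.aemeasurable
  have := isProbabilityMeasure_expMeasure (add_pos hr hs)
  have := Measure.isProbabilityMeasure_map hm
  have tail (x : ℝ) : (P.map fun ω => min (X ω) (Y ω)).real (Set.Ioi x) =
      (expMeasure (r + s)).real (Set.Ioi x) :=
    calc (P.map fun ω => min (X ω) (Y ω)).real (Set.Ioi x)
      _ = P.real (X ⁻¹' Set.Ioi x ∩ Y ⁻¹' Set.Ioi x) := by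
        rw [map_measureReal_apply_of_aemeasurable hm measurableSet_Ioi]
        congr 1 with ω
        simp
      _ = P.real (X ⁻¹' Set.Ioi x) * P.real (Y ⁻¹' Set.Ioi x) := by
        simp only [Measure.real, hXY.measure_inter_preimage_eq_mul _ _ measurableSet_Ioi
          measurableSet_Ioi, ENNReal.toReal_mul]
      _ = (expMeasure r).real (Set.Ioi x) * (expMeasure s).real (Set.Ioi x) :=
        congrArg₂ _ (hX.measureReal_eq (p := fun y => x < y) measurableSet_Ioi)
          (hY.measureReal_eq (p := fun y => x < y) measurableSet_Ioi)
      _ = (expMeasure (r + s)).real (Set.Ioi x) := by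
        rw [expMeasure_real_Ioi hr, expMeasure_real_Ioi hs, expMeasure_real_Ioi (add_pos hr hs),
          ← Real.exp_add]
        ring_nf
  refine ⟨hm, Measure.eq_of_cdf _ _ ?_⟩
  ext x
  simp only [cdf_eq_real, ← Set.compl_Ioi, probReal_compl_eq_one_sub measurableSet_Ioi, tail]

end

/-! ### Independence -/

lemma iIndepFun_curry {Ω ι κ 𝓧 : Type*} [MeasurableSpace Ω] [MeasurableSpace 𝓧] {P : Measure Ω}
    [IsProbabilityMeasure P] {X : ι → κ → Ω → 𝓧} (hm : ∀ i j, Measurable (X i j))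
    (h : iIndepFun (fun p : ι × κ => X p.1 p.2) P) : iIndepFun (fun i ω j => X i j ω) P := by
  have (i : ι) (j : κ) : IsProbabilityMeasure (P.map (X i j)) :=
    Measure.isProbabilityMeasure_map (hm i j).aemeasurable
  have row (i : ι) : P.map (fun ω j => X i j ω) = Measure.infinitePi fun j => P.map (X i j) :=
    (h.precomp (g := fun j => (i, j)) (Prod.mk_right_injective i)).map_fun_eq_infinitePi_map (hm i)
  have joint := Measure.infinitePi_map_curry fun i j => P.map (X i j)
  rw [← h.map_fun_eq_infinitePi_map fun p : ι × κ => hm p.1 p.2,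
    Measure.map_map (MeasurableEquiv.measurable _)
      (measurable_pi_lambda _ fun p : ι × κ => hm p.1 p.2)] at joint
  rw [iIndepFun_iff_map_fun_eq_infinitePi_map fun i => measurable_pi_lambda _ (hm i)]
  simp only [row]
  exact joint

lemma indepFun_of_measurable_past {Ω 𝓨 : Type*} {mΩ : MeasurableSpace Ω} [MeasurableSpace 𝓨]
    {P : Measure Ω} {𝓧 : ℕ → Type*} [∀ n, MeasurableSpace (𝓧 n)] {D : ∀ n, Ω → 𝓧 n}
    (hD : ∀ n, Measurable (D n)) (hi : iIndepFun D P) {n : ℕ} {Z : Ω → 𝓨}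
    (hZ : Measurable[⨆ k < n, MeasurableSpace.comap (D k) inferInstance] Z) :
    IndepFun Z (D n) P := by
  have past_future := indep_iSup_of_disjoint (fun k => (hD k).comap_le) hi
    (S := Set.Iio n) (T := {n}) (by simp)
  simp only [Set.mem_Iio, Set.mem_singleton_iff, iSup_iSup_eq_left] at past_future
  exact (IndepFun_iff_Indep ..).2 (indep_of_indep_of_le_left past_future hZ.comap_le)

lemma setIntegral_preimage_prodMk_of_indepFun {Ω 𝓧 𝓨 E : Type*} [MeasurableSpace Ω]
    [MeasurableSpace 𝓧] [MeasurableSpace 𝓨] [NormedAddCommGroup E] [NormedSpace ℝ E]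
    {P : Measure Ω} [IsFiniteMeasure P] {ν : Measure 𝓨} [SFinite ν] {Z : Ω → 𝓧} {Y : Ω → 𝓨}
    (hZ : AEMeasurable Z P) (hY : HasLaw Y ν P) (hZY : IndepFun Z Y P)
    {φ : 𝓧 × 𝓨 → E} (hφ : StronglyMeasurable φ) {B : Set 𝓧} (hB : MeasurableSet B)
    (hint : IntegrableOn (fun ω => φ (Z ω, Y ω)) (Z ⁻¹' B) P) :
    ∫ ω in Z ⁻¹' B, φ (Z ω, Y ω) ∂P = ∫ ω in Z ⁻¹' B, ∫ y, φ (Z ω, y) ∂ν ∂P := by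
  have joint : HasLaw (fun ω => (Z ω, Y ω)) ((P.map Z).prod ν) P :=
    hZY.hasLaw_prod ⟨hZ, rfl⟩ hY
  have preimage : (fun ω => (Z ω, Y ω)) ⁻¹' (B ×ˢ Set.univ) = Z ⁻¹' B := by
    rw [Set.mk_preimage_prod, Set.preimage_univ, Set.inter_univ]
  have hint' : IntegrableOn φ (B ×ˢ Set.univ) ((P.map Z).prod ν) := by
    rw [← joint.map_eq, IntegrableOn,
      Measure.restrict_map_of_aemeasurable joint.aemeasurable (hB.prod .univ), preimage]
    exact (integrable_map_measure hφ.aestronglyMeasurable joint.aemeasurable.restrict).2 hint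
  calc ∫ ω in Z ⁻¹' B, φ (Z ω, Y ω) ∂P
    _ = ∫ p in B ×ˢ Set.univ, φ p ∂(P.map Z).prod ν := by
      rw [← joint.map_eq, setIntegral_map (hB.prod .univ) hφ.aestronglyMeasurable
        joint.aemeasurable, preimage]
    _ = ∫ z in B, ∫ y, φ (z, y) ∂ν ∂P.map Z := by
      rw [setIntegral_prod _ hint', Measure.restrict_univ]
    _ = ∫ ω in Z ⁻¹' B, ∫ y, φ (Z ω, y) ∂ν ∂P :=
      setIntegral_map hB hφ.integral_prod_right'.aestronglyMeasurable hZ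

lemma ae_frequently_lt_of_hasLaw_expMeasure {Ω : Type*} [MeasurableSpace Ω] {P : Measure Ω}
    [IsProbabilityMeasure P] {X : ℕ → Ω → ℝ} (hX : ∀ n, Measurable (X n)) (hi : iIndepFun X P)
    {r : ℕ → ℝ} {R : ℝ} (hr : ∀ n, 0 < r n) (hR : ∀ n, r n ≤ R)
    (hlaw : ∀ n, HasLaw (X n) (expMeasure (r n)) P) (c : ℝ) :
    ∀ᵐ ω ∂P, ∃ᶠ n in atTop, c < X n ω := by
  have hs (n : ℕ) : MeasurableSet {ω | c < X n ω} := hX n measurableSet_Ioi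
  have hind : iIndepSet (fun n => {ω | c < X n ω}) P :=
    (iIndepSet_iff_meas_biInter hs).2 fun s =>
      hi.meas_biInter fun i _ => ⟨Set.Ioi c, measurableSet_Ioi, rfl⟩
  have lower (n : ℕ) : ENNReal.ofReal (Real.exp (-(R * max c 0))) ≤ P {ω | c < X n ω} := by
    have := isProbabilityMeasure_expMeasure (hr n)
    rw [(hlaw n).measure_eq (p := fun x => c < x) measurableSet_Ioi]
    change _ ≤ expMeasure (r n) (Set.Ioi c)
    rw [← ofReal_measureReal, expMeasure_real_Ioi (hr n)]
    gcongr
    exact hR n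
  have hsum : ∑' n, P {ω | c < X n ω} = ⊤ := by
    refine top_le_iff.1 ((ENNReal.tsum_const_eq_top_of_ne_zero (α := ℕ) ?_).ge.trans
      (ENNReal.tsum_le_tsum lower))
    simp [Real.exp_pos]
  have hlimsup := (mem_ae_iff_prob_eq_one (MeasurableSet.measurableSet_limsup hs)).2
    (measure_limsup_eq_one hs hind hsum)
  filter_upwards [hlimsup] with ω hω
  simpa only [mem_limsup_iff_frequently_mem, Set.mem_ofPred_eq] using hω

/-! ### Phases -/

lemma phaseStep_succ' (q : Fin 2) (n : ℕ) : phaseStep q (n + 1) = phaseStep (q + 1) n := by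
  induction n with
  | zero => rfl
  | succ n ih => exact congrArg (· + 1) ih

lemma phaseStart_zero (d : ℕ → ℝ) : phaseStart d 0 = 0 := Finset.sum_range_zero d

lemma phaseStart_succ (d : ℕ → ℝ) (n : ℕ) : phaseStart d (n + 1) = phaseStart d n + d n :=
  Finset.sum_range_succ d n

lemma norm_completeStep_le (q : Fin 2) (x : Fin 2 → ℝ) : ‖completeStep q x‖ ≤ ‖x‖ := by
  unfold completeStep
  split_ifs
  · exact le_rfl
  · refine (pi_norm_le_iff_of_nonneg (norm_nonneg x)).2 (Fin.forall_fin_two.2 ⟨?_, ?_⟩)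
    · exact norm_le_pi_norm x 1
    · simp

lemma continuous_completeStep (q : Fin 2) : Continuous (completeStep q) := by
  unfold completeStep
  split_ifs <;> fun_prop

lemma norm_add_const_le {ι : Type*} [Fintype ι] (x : ι → ℝ) {s : ℝ} (hs : 0 ≤ s) :
    ‖fun j => x j + s‖ ≤ ‖x‖ + s :=
  (pi_norm_le_iff_of_nonneg (by positivity)).2 fun j =>
    (norm_add_le _ _).trans (add_le_add (norm_le_pi_norm x j) (Real.norm_of_nonneg hs).le)

section

variable {d : ℕ → ℝ} (hd : ∀ n, 0 ≤ d n)
include hd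

lemma phaseStart_mono : Monotone (phaseStart d) :=
  monotone_nat_of_le_succ fun n => by rw [phaseStart_succ]; exact le_add_of_nonneg_right (hd n)

lemma phaseStart_nonneg (n : ℕ) : 0 ≤ phaseStart d n := Finset.sum_nonneg fun k _ => hd k

lemma tendsto_phaseStart_atTop {c : ℝ} (hc : 0 < c) (hfreq : ∃ᶠ n in atTop, c < d n) :
    Tendsto (phaseStart d) atTop atTop := by
  refine (not_summable_iff_tendsto_nat_atTop_of_nonneg hd).1 fun hsum => ?_
  exact hfreq ((hsum.tendsto_atTop_zero.eventually_lt_const hc).mono fun n hn => hn.le.not_gt)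

lemma phaseAt_eq {t : ℝ} {n : ℕ} (h_start : phaseStart d n ≤ t) (h_end : t < phaseStart d (n + 1)) :
    phaseAt d t = n := by
  have : {k : ℕ | phaseStart d k ≤ t} = Set.Iic n := by
    ext k
    refine ⟨fun hk => ?_, fun hk => (phaseStart_mono hd hk).trans h_start⟩
    exact Nat.lt_succ_iff.1 ((phaseStart_mono hd).reflect_lt (lt_of_le_of_lt hk h_end))
  rw [phaseAt, this, csSup_Iic]

lemma phaseStart_phaseAt_le {t : ℝ} (ht : 0 ≤ t) (hn : ∃ n, t < phaseStart d n) :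
    phaseStart d (phaseAt d t) ≤ t := by
  obtain ⟨n, hn⟩ := hn
  refine Nat.sSup_mem (s := {k | phaseStart d k ≤ t}) ⟨0, ?_⟩ ⟨n, fun k hk => ?_⟩
  · simpa only [Set.mem_ofPred_eq, phaseStart_zero] using ht
  · exact ((phaseStart_mono hd).reflect_lt (lt_of_le_of_lt hk hn)).le

lemma norm_ageAtPhase_le (q₀ : Fin 2) (a : Fin 2 → ℝ) (n : ℕ) :
    ‖ageAtPhase q₀ a d n‖ ≤ ‖a‖ + phaseStart d n := by
  induction n with
  | zero => simp [ageAtPhase, phaseStart]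
  | succ n ih =>
    calc ‖ageAtPhase q₀ a d (n + 1)‖
      _ ≤ ‖fun j => ageAtPhase q₀ a d n j + d n‖ := norm_completeStep_le _ _
      _ ≤ ‖ageAtPhase q₀ a d n‖ + d n := norm_add_const_le _ (hd n)
      _ ≤ ‖a‖ + phaseStart d (n + 1) := by rw [phaseStart_succ]; linarith

lemma norm_agesAt_le (q₀ : Fin 2) (a : Fin 2 → ℝ) {t : ℝ} (ht : 0 ≤ t)
    (hn : ∃ n, t < phaseStart d n) : ‖agesAt q₀ a d t‖ ≤ ‖a‖ + t :=
  calc ‖agesAt q₀ a d t‖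
    _ ≤ ‖ageAtPhase q₀ a d (phaseAt d t)‖ + (t - phaseStart d (phaseAt d t)) :=
      norm_add_const_le _ (sub_nonneg.2 (phaseStart_phaseAt_le hd ht hn))
    _ ≤ ‖a‖ + t := by linarith [norm_ageAtPhase_le hd q₀ a (phaseAt d t)]

end

section

variable {Ω : Type*} {mΩ : MeasurableSpace Ω} {D : ℕ → Ω → ℝ} {n : ℕ}
  (hD : ∀ k < n, Measurable (D k))
include hD

lemma measurable_phaseStart : Measurable fun ω => phaseStart (D · ω) n :=
  Finset.measurable_fun_sum _ fun k hk => hD k (Finset.mem_range.1 hk)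

lemma measurable_ageAtPhase (q₀ : Fin 2) (a : Fin 2 → ℝ) :
    Measurable fun ω => ageAtPhase q₀ a (D · ω) n := by
  induction n with
  | zero => exact measurable_const
  | succ n ih =>
    have := ih fun k hk => hD k (hk.trans n.lt_succ_self)
    have := hD n n.lt_succ_self
    exact (continuous_completeStep _).measurable.comp (by fun_prop)

end

/-- The phases of the alternating-step system have independent durations `D 0, D 1, …`, those of
step `q` being exponential with rate `r q`; phase `0` executes step `q₀`. -/
structure IsExpStepDurations {Ω : Type*} [MeasurableSpace Ω] (P : Measure Ω) (r : Fin 2 → ℝ)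
    (q₀ : Fin 2) (D : ℕ → Ω → ℝ) : Prop where
  measurable : ∀ n, Measurable (D n)
  indep : iIndepFun D P
  law : ∀ n, HasLaw (D n) (expMeasure (r (phaseStep q₀ n))) P

namespace IsExpStepDurations

variable {Ω : Type*} [MeasurableSpace Ω] {P : Measure Ω} {r : Fin 2 → ℝ} {q₀ : Fin 2}
  {D : ℕ → Ω → ℝ}

lemma ae_nonneg (h : IsExpStepDurations P r q₀ D) (hr : ∀ q, 0 < r q) :
    ∀ᵐ ω ∂P, ∀ n, 0 ≤ D n ω :=
  ae_all_iff.2 fun n => (ae_pos_of_hasLaw_expMeasure (hr _) (h.law n)).mono fun _ => le_of_lt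

lemma ae_tendsto_phaseStart [IsProbabilityMeasure P] (h : IsExpStepDurations P r q₀ D)
    (hr : ∀ q, 0 < r q) : ∀ᵐ ω ∂P, Tendsto (phaseStart (D · ω)) atTop atTop := by
  filter_upwards [h.ae_nonneg hr, ae_frequently_lt_of_hasLaw_expMeasure h.measurable h.indep
    (fun n => hr _) (fun n => (le_ciSup (Set.finite_range r).bddAbove _)) h.law 1] with ω hω hfreq
  exact tendsto_phaseStart_atTop hω one_pos hfreq

lemma indepFun_phaseStart_ageAtPhase (h : IsExpStepDurations P r q₀ D) (a : Fin 2 → ℝ) (n : ℕ) :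
    IndepFun (fun ω => (phaseStart (D · ω) n, ageAtPhase q₀ a (D · ω) n)) (D n) P := by
  have past (k : ℕ) (hk : k < n) :
      Measurable[⨆ k < n, MeasurableSpace.comap (D k) inferInstance] (D k) :=
    Measurable.mono (comap_measurable (D k))
      (le_iSup₂ (f := fun k (_ : k < n) => MeasurableSpace.comap (D k) inferInstance) k hk) le_rfl
  exact indepFun_of_measurable_past h.measurable h.indep
    (Measurable.prodMk (measurable_phaseStart past) (measurable_ageAtPhase past q₀ a))

end IsExpStepDurations

/-! ### The backward equation -/

/-- `F q τ x` solves the backward equation of the alternating-step system with rates `r`, where `x`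
are the ages when step `q` starts and `τ` is the time left. The equation
`(∂_τ - ∂_{x₀} - ∂_{x₁}) F q = r q * (F (q + 1) (completeStep q) - F q)` is imposed along its
characteristics `s ↦ (τ - s, x + s)`, so that `F` need not be differentiable in `x`. -/
structure IsBackwardSolution (r : Fin 2 → ℝ) (F : Fin 2 → ℝ → (Fin 2 → ℝ) → ℝ) : Prop where
  continuous : ∀ q, Continuous fun p : ℝ × (Fin 2 → ℝ) => F q p.1 p.2
  hasDerivAt : ∀ (q : Fin 2) (τ : ℝ) (x : Fin 2 → ℝ) (s : ℝ),
    HasDerivAt (fun s => F q (τ - s) fun j => x j + s)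
      (r q * (F q (τ - s) (fun j => x j + s) -
        F (q + 1) (τ - s) (completeStep q fun j => x j + s))) s

/-- The value of `F` at the end of the phase if a phase of step `q` that starts with ages `x` and
time `τ` left lasts `y ≤ τ`, and its value when the time runs out otherwise. -/
noncomputable def phaseOutcome (F : Fin 2 → ℝ → (Fin 2 → ℝ) → ℝ) (q : Fin 2) (τ : ℝ)
    (x : Fin 2 → ℝ) (y : ℝ) : ℝ :=
  if τ < y then F q 0 fun j => x j + τ
  else F (q + 1) (τ - y) (completeStep q fun j => x j + y)

/-- The value of `F`, with time horizon `t`, at the start of phase `n`, or when the time runs out if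
this happens earlier. Along random durations this is a bounded martingale in `n`. -/
noncomputable def pathValue (F : Fin 2 → ℝ → (Fin 2 → ℝ) → ℝ) (q₀ : Fin 2) (a : Fin 2 → ℝ) (t : ℝ)
    (d : ℕ → ℝ) (n : ℕ) : ℝ :=
  if phaseStart d n ≤ t then F (phaseStep q₀ n) (t - phaseStart d n) (ageAtPhase q₀ a d n)
  else F (stateAt q₀ d t) 0 (agesAt q₀ a d t)

section

variable (F : Fin 2 → ℝ → (Fin 2 → ℝ) → ℝ) (q₀ : Fin 2) (a : Fin 2 → ℝ) {t : ℝ} {d : ℕ → ℝ} {n : ℕ}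

lemma pathValue_of_le (h : phaseStart d n ≤ t) : pathValue F q₀ a t d n =
    F (phaseStep q₀ n) (t - phaseStart d n) (ageAtPhase q₀ a d n) := if_pos h

lemma pathValue_of_lt (h : t < phaseStart d n) :
    pathValue F q₀ a t d n = F (stateAt q₀ d t) 0 (agesAt q₀ a d t) := if_neg h.not_ge

lemma pathValue_zero (ht : 0 ≤ t) : pathValue F q₀ a t d 0 = F q₀ t a := by
  rw [pathValue_of_le, phaseStart_zero, sub_zero, phaseStep, ageAtPhase]
  rwa [phaseStart_zero]

lemma pathValue_succ_of_le (hd : ∀ n, 0 ≤ d n) (h : phaseStart d n ≤ t) :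
    pathValue F q₀ a t d (n + 1) =
      phaseOutcome F (phaseStep q₀ n) (t - phaseStart d n) (ageAtPhase q₀ a d n) (d n) := by
  have hsucc := phaseStart_succ d n
  rcases le_or_gt (phaseStart d (n + 1)) t with h' | h'
  · rw [phaseOutcome, if_neg (by linarith), pathValue_of_le _ _ _ h', hsucc, ← sub_sub]
    rfl
  · rw [phaseOutcome, if_pos (by linarith), pathValue_of_lt _ _ _ h', stateAt,
      phaseAt_eq hd h h']
    congr 1 with j
    rw [agesAt, phaseAt_eq hd h h']

lemma pathValue_succ_of_lt (hd : ∀ n, 0 ≤ d n) (h : t < phaseStart d n) :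
    pathValue F q₀ a t d (n + 1) = pathValue F q₀ a t d n := by
  rw [pathValue_of_lt _ _ _ h,
    pathValue_of_lt _ _ _ (h.trans_le (phaseStart_mono hd n.le_succ))]

lemma tendsto_pathValue (h : Tendsto (phaseStart d) atTop atTop) :
    Tendsto (pathValue F q₀ a t d) atTop (𝓝 (F (stateAt q₀ d t) 0 (agesAt q₀ a d t))) :=
  tendsto_const_nhds.congr' <| (h.eventually_gt_atTop t).mono fun _ hn =>
    (pathValue_of_lt _ _ _ hn).symm

end

lemma measurable_phaseOutcome {F : Fin 2 → ℝ → (Fin 2 → ℝ) → ℝ}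
    (hF : ∀ q, Measurable fun p : ℝ × (Fin 2 → ℝ) => F q p.1 p.2) (q : Fin 2) :
    Measurable fun p : (ℝ × (Fin 2 → ℝ)) × ℝ => phaseOutcome F q p.1.1 p.1.2 p.2 := by
  refine Measurable.ite (measurableSet_lt (by fun_prop) (by fun_prop)) ?_ ?_
  · exact (hF q).comp (f := fun p : (ℝ × (Fin 2 → ℝ)) × ℝ => ((0 : ℝ), fun j => p.1.2 j + p.1.1))
      (by fun_prop)
  · have := (continuous_completeStep q).measurable
    exact (hF (q + 1)).comp (f := fun p : (ℝ × (Fin 2 → ℝ)) × ℝ =>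
      (p.1.1 - p.2, completeStep q fun j => p.1.2 j + p.2)) (by fun_prop)

namespace IsBackwardSolution

variable {r : Fin 2 → ℝ} {F : Fin 2 → ℝ → (Fin 2 → ℝ) → ℝ}

lemma continuous_kernel (hF : IsBackwardSolution r F) (q : Fin 2) (τ : ℝ) (x : Fin 2 → ℝ) :
    Continuous fun s => r q * Real.exp (-(r q * s)) *
      F (q + 1) (τ - s) (completeStep q fun j => x j + s) := by
  have := continuous_completeStep q
  have := (hF.continuous (q + 1)).comp (f := fun s : ℝ =>
    (τ - s, completeStep q fun j => x j + s)) (by fun_prop)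
  exact Continuous.mul (by fun_prop) this

lemma intervalIntegral_kernel (hF : IsBackwardSolution r F) (q : Fin 2) (τ : ℝ) (x : Fin 2 → ℝ) :
    ∫ s in (0 : ℝ)..τ, r q * Real.exp (-(r q * s)) *
        F (q + 1) (τ - s) (completeStep q fun j => x j + s) =
      F q τ x - Real.exp (-(r q * τ)) * F q 0 fun j => x j + τ := by
  have hderiv (s : ℝ) : HasDerivAt
      (fun s => -Real.exp (-(r q * s)) * F q (τ - s) fun j => x j + s)
      (r q * Real.exp (-(r q * s)) * F (q + 1) (τ - s) (completeStep q fun j => x j + s)) s :=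
    (hasDerivAt_neg_exp_mul_exp.mul (hF.hasDerivAt q τ x s)).congr_deriv (by ring)
  rw [intervalIntegral.integral_eq_sub_of_hasDerivAt (fun s _ => hderiv s)
    ((hF.continuous_kernel q τ x).intervalIntegrable _ _)]
  simp only [sub_self, sub_zero, mul_zero, neg_zero, Real.exp_zero, add_zero]
  ring

lemma integral_phaseOutcome (hF : IsBackwardSolution r F) {q : Fin 2} (hr : 0 < r q) {τ : ℝ}
    (hτ : 0 ≤ τ) (x : Fin 2 → ℝ) : ∫ y, phaseOutcome F q τ x y ∂expMeasure (r q) = F q τ x := by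
  have hinside : Set.EqOn (fun y => r q * Real.exp (-(r q * y)) * phaseOutcome F q τ x y)
      (fun y => r q * Real.exp (-(r q * y)) *
        F (q + 1) (τ - y) (completeStep q fun j => x j + y)) (Set.Ioc 0 τ) := fun y hy => by
    simp only [phaseOutcome, if_neg hy.2.not_gt]
  have houtside : Set.EqOn (fun y => r q * Real.exp (-(r q * y)) * phaseOutcome F q τ x y)
      (fun y => Real.exp (-r q * y) * (r q * F q 0 fun j => x j + τ)) (Set.Ioi τ) :=
    fun y hy => by
      simp only [phaseOutcome, if_pos (Set.mem_Ioi.1 hy), neg_mul]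
      ring
  have hin : IntegrableOn _ (Set.Ioc 0 τ) :=
    (integrableOn_congr_fun hinside measurableSet_Ioc).2
      ((hF.continuous_kernel q τ x).integrableOn_Icc.mono_set Set.Ioc_subset_Icc_self)
  have hout : IntegrableOn _ (Set.Ioi τ) :=
    (integrableOn_congr_fun houtside measurableSet_Ioi).2
      ((exp_neg_integrableOn_Ioi τ hr).mul_const _)
  rw [integral_expMeasure hr, ← Set.Ioc_union_Ioi_eq_Ioi hτ,
    setIntegral_union (Set.Ioc_disjoint_Ioi le_rfl) measurableSet_Ioi hin hout,
    setIntegral_congr_fun measurableSet_Ioc hinside,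
    setIntegral_congr_fun measurableSet_Ioi houtside, ← intervalIntegral.integral_of_le hτ,
    hF.intervalIntegral_kernel, integral_mul_const, integral_exp_mul_Ioi (neg_lt_zero.2 hr),
    neg_mul]
  field_simp
  ring

lemma exists_forall_abs_le (hF : IsBackwardSolution r F) (t M : ℝ) :
    ∃ C, ∀ q, ∀ τ ∈ Set.Icc 0 t, ∀ x, ‖x‖ ≤ M → |F q τ x| ≤ C := by
  have hK : IsCompact (Set.Icc (0 : ℝ) t ×ˢ Metric.closedBall (0 : Fin 2 → ℝ) M) :=
    isCompact_Icc.prod (isCompact_closedBall 0 M)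
  choose C hC using fun q => hK.exists_bound_of_continuousOn (hF.continuous q).continuousOn
  exact ⟨⨆ q, C q, fun q τ hτ x hx => (hC q (τ, x) ⟨hτ, mem_closedBall_zero_iff.2 hx⟩).trans
    (le_ciSup (Set.finite_range C).bddAbove q)⟩

lemma exists_forall_abs_pathValue_le (hF : IsBackwardSolution r F) (q₀ : Fin 2) (a : Fin 2 → ℝ)
    {t : ℝ} (ht : 0 ≤ t) :
    ∃ C, ∀ d : ℕ → ℝ, (∀ n, 0 ≤ d n) → ∀ n, |pathValue F q₀ a t d n| ≤ C := by
  obtain ⟨C, hC⟩ := hF.exists_forall_abs_le t (‖a‖ + t)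
  refine ⟨C, fun d hd n => ?_⟩
  rcases le_or_gt (phaseStart d n) t with h | h
  · rw [pathValue_of_le _ _ _ h]
    exact hC _ _ ⟨sub_nonneg.2 h, sub_le_self t (phaseStart_nonneg hd n)⟩ _
      ((norm_ageAtPhase_le hd q₀ a n).trans (by gcongr))
  · rw [pathValue_of_lt _ _ _ h]
    exact hC _ _ ⟨le_rfl, ht⟩ _ (norm_agesAt_le hd q₀ a ht ⟨n, h⟩)

end IsBackwardSolution

namespace IsExpStepDurations

variable {Ω : Type*} [MeasurableSpace Ω] {P : Measure Ω} {r : Fin 2 → ℝ}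
  {q₀ : Fin 2} {D : ℕ → Ω → ℝ} {F : Fin 2 → ℝ → (Fin 2 → ℝ) → ℝ} {t : ℝ}
  (h : IsExpStepDurations P r q₀ D) (hr : ∀ q, 0 < r q) (hF : IsBackwardSolution r F) (ht : 0 ≤ t)
  (a : Fin 2 → ℝ)
include h hr hF ht

lemma aestronglyMeasurable_pathValue (n : ℕ) :
    AEStronglyMeasurable (fun ω => pathValue F q₀ a t (D · ω) n) P := by
  induction n with
  | zero => simpa only [pathValue_zero F q₀ a ht] using aestronglyMeasurable_const
  | succ n ih =>
    have hS := measurable_phaseStart (n := n) fun k _ => h.measurable k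
    have hA := measurable_ageAtPhase (n := n) (fun k _ => h.measurable k) q₀ a
    have hD := h.measurable n
    have hstarted : MeasurableSet {ω | phaseStart (D · ω) n ≤ t} :=
      measurableSet_le hS measurable_const
    have hout := (measurable_phaseOutcome (fun q => (hF.continuous q).measurable)
      (phaseStep q₀ n)).comp (f := fun ω =>
        ((t - phaseStart (D · ω) n, ageAtPhase q₀ a (D · ω) n), D n ω)) (by fun_prop)
    refine (AEStronglyMeasurable.piecewise hstarted
      hout.aestronglyMeasurable.restrict ih.restrict).congr ?_
    filter_upwards [h.ae_nonneg hr] with ω hω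
    rcases le_or_gt (phaseStart (D · ω) n) t with hle | hlt
    · exact (Set.piecewise_eq_of_mem {ω | phaseStart (D · ω) n ≤ t} _ _ hle).trans
        (pathValue_succ_of_le F q₀ a hω hle).symm
    · exact (Set.piecewise_eq_of_notMem {ω | phaseStart (D · ω) n ≤ t} _ _ hlt.not_ge).trans
        (pathValue_succ_of_lt F q₀ a hω hlt).symm

lemma integrable_pathValue [IsProbabilityMeasure P] (n : ℕ) :
    Integrable (fun ω => pathValue F q₀ a t (D · ω) n) P := by
  obtain ⟨C, hC⟩ := hF.exists_forall_abs_pathValue_le q₀ a ht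
  exact .of_bound (h.aestronglyMeasurable_pathValue hr hF ht a n) C
    ((h.ae_nonneg hr).mono fun ω hω => hC _ hω n)

lemma integral_pathValue_succ [IsProbabilityMeasure P] (n : ℕ) :
    ∫ ω, pathValue F q₀ a t (D · ω) (n + 1) ∂P = ∫ ω, pathValue F q₀ a t (D · ω) n ∂P := by
  have := isProbabilityMeasure_expMeasure (hr (phaseStep q₀ n))
  let Z : Ω → ℝ × (Fin 2 → ℝ) := fun ω => (phaseStart (D · ω) n, ageAtPhase q₀ a (D · ω) n)
  have hZ : Measurable Z := (measurable_phaseStart fun k _ => h.measurable k).prodMk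
    (measurable_ageAtPhase (fun k _ => h.measurable k) q₀ a)
  have hB : MeasurableSet {z : ℝ × (Fin 2 → ℝ) | z.1 ≤ t} :=
    measurableSet_le measurable_fst measurable_const
  let φ : (ℝ × (Fin 2 → ℝ)) × ℝ → ℝ := fun p =>
    phaseOutcome F (phaseStep q₀ n) (t - p.1.1) p.1.2 p.2
  have hφ : Measurable φ := (measurable_phaseOutcome (fun q => (hF.continuous q).measurable)
    (phaseStep q₀ n)).comp (f := fun p : (ℝ × (Fin 2 → ℝ)) × ℝ => ((t - p.1.1, p.1.2), p.2))
      (by fun_prop)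
  have hstarted : ∀ᵐ ω ∂P, ω ∈ Z ⁻¹' {z | z.1 ≤ t} →
      pathValue F q₀ a t (D · ω) (n + 1) = φ (Z ω, D n ω) :=
    (h.ae_nonneg hr).mono fun ω hω hle => pathValue_succ_of_le F q₀ a hω hle
  have hint := h.integrable_pathValue hr hF ht a
  have hφint : IntegrableOn (fun ω => φ (Z ω, D n ω)) (Z ⁻¹' {z | z.1 ≤ t}) P :=
    (hint (n + 1)).integrableOn.congr_fun_ae ((ae_restrict_iff' (hZ hB)).2 hstarted)
  rw [← integral_add_compl (hZ hB) (hint (n + 1)), ← integral_add_compl (hZ hB) (hint n),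
    setIntegral_congr_ae (hZ hB) hstarted, setIntegral_preimage_prodMk_of_indepFun hZ.aemeasurable
      (h.law n) (h.indepFun_phaseStart_ageAtPhase a n) hφ.stronglyMeasurable hB hφint]
  congr 1
  · refine setIntegral_congr_fun (hZ hB) fun ω hω => ?_
    exact (hF.integral_phaseOutcome (hr _) (sub_nonneg.2 hω) _).trans
      (pathValue_of_le F q₀ a hω).symm
  · refine setIntegral_congr_ae (hZ hB).compl ((h.ae_nonneg hr).mono fun ω hω hnot => ?_)
    exact pathValue_succ_of_lt F q₀ a hω (not_le.1 hnot)

theorem integrable_and_integral_eq [IsProbabilityMeasure P] :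
    Integrable (fun ω => F (stateAt q₀ (D · ω) t) 0 (agesAt q₀ a (D · ω) t)) P ∧
      ∫ ω, F (stateAt q₀ (D · ω) t) 0 (agesAt q₀ a (D · ω) t) ∂P = F q₀ t a := by
  have hconst (n : ℕ) : ∫ ω, pathValue F q₀ a t (D · ω) n ∂P = F q₀ t a := by
    induction n with
    | zero => simp [pathValue_zero F q₀ a ht]
    | succ n ih => rw [h.integral_pathValue_succ hr hF ht a, ih]
  obtain ⟨C, hC⟩ := hF.exists_forall_abs_pathValue_le q₀ a ht
  have hbound (n : ℕ) : ∀ᵐ ω ∂P, ‖pathValue F q₀ a t (D · ω) n‖ ≤ C :=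
    (h.ae_nonneg hr).mono fun ω hω => hC _ hω n
  have hmeas := h.aestronglyMeasurable_pathValue hr hF ht a
  have hlim : ∀ᵐ ω ∂P, Tendsto (pathValue F q₀ a t (D · ω)) atTop
      (𝓝 (F (stateAt q₀ (D · ω) t) 0 (agesAt q₀ a (D · ω) t))) :=
    (h.ae_tendsto_phaseStart hr).mono fun ω hω => tendsto_pathValue F q₀ a hω
  have hlim_bound : ∀ᵐ ω ∂P, ‖F (stateAt q₀ (D · ω) t) 0 (agesAt q₀ a (D · ω) t)‖ ≤ C := by
    filter_upwards [hlim, ae_all_iff.2 hbound] with ω hω hb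
    exact le_of_tendsto' hω.norm hb
  refine ⟨.of_bound (aestronglyMeasurable_of_tendsto_ae atTop hmeas hlim) C hlim_bound, ?_⟩
  have := tendsto_integral_of_dominated_convergence (fun _ => C) hmeas (integrable_const C)
    hbound hlim
  simp only [hconst] at this
  exact tendsto_nhds_unique this tendsto_const_nhds

end IsExpStepDurations

/-! ### Exponential filters -/

/-- The solution of `y' = l * (f - y)` with `y 0 = 0`. For `l > 0` and `t ≥ 0` it is the expectation
of `f (t - X)` on `{X ≤ t}`, where `X` is exponential with rate `l`. -/
noncomputable def expFilter (l : ℝ) (f : ℝ → ℝ) (t : ℝ) : ℝ :=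
  ∫ s in (0 : ℝ)..t, l * Real.exp (-(l * (t - s))) * f s

lemma expFilter_zero (l : ℝ) (f : ℝ → ℝ) : expFilter l f 0 = 0 := intervalIntegral.integral_same

lemma expFilter_neg (l : ℝ) (f : ℝ → ℝ) (t : ℝ) : expFilter l (-f) t = -expFilter l f t := by
  simp only [expFilter, Pi.neg_apply, mul_neg, intervalIntegral.integral_neg]

lemma expFilter_eq_exp_mul (l : ℝ) (f : ℝ → ℝ) (t : ℝ) :
    expFilter l f t = Real.exp (-(l * t)) * ∫ s in (0 : ℝ)..t, l * Real.exp (l * s) * f s := by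
  rw [expFilter, ← intervalIntegral.integral_const_mul]
  congr 1 with s
  rw [mul_sub, neg_sub, sub_eq_neg_add, Real.exp_add]
  ring

lemma expFilter_eq_integral_expMeasure {l t : ℝ} (hl : 0 < l) (ht : 0 ≤ t) (f : ℝ → ℝ) :
    expFilter l f t = ∫ u, (Set.Iic t).indicator (fun u => f (t - u)) u ∂expMeasure l := by
  have hind (u : ℝ) : l * Real.exp (-(l * u)) * (Set.Iic t).indicator (fun u => f (t - u)) u =
      (Set.Iic t).indicator (fun u => l * Real.exp (-(l * u)) * f (t - u)) u :=
    (Set.indicator_mul_right (Set.Iic t) (fun u => l * Real.exp (-(l * u)))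
      (fun u => f (t - u))).symm
  have hsub := intervalIntegral.integral_comp_sub_left
    (fun s => l * Real.exp (-(l * (t - s))) * f s) t (a := 0) (b := t)
  simp only [sub_sub_cancel, sub_self, sub_zero] at hsub
  rw [integral_expMeasure hl, expFilter, ← hsub, intervalIntegral.integral_of_le ht]
  simp only [hind]
  rw [setIntegral_indicator measurableSet_Iic, Set.Ioi_inter_Iic]

lemma hasDerivAt_exp_neg_mul (l t : ℝ) :
    HasDerivAt (fun t => Real.exp (-(l * t))) (-(l * Real.exp (-(l * t)))) t :=
  ((hasDerivAt_id t).const_mul l).neg.exp.congr_deriv (by simp [mul_comm])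

section

variable (l : ℝ) {f : ℝ → ℝ} (hf : Continuous f)
include hf

lemma hasDerivAt_expFilter (t : ℝ) :
    HasDerivAt (expFilter l f) (l * (f t - expFilter l f t)) t := by
  have hint : HasDerivAt (fun t => ∫ s in (0 : ℝ)..t, l * Real.exp (l * s) * f s)
      (l * Real.exp (l * t) * f t) t :=
    ((by fun_prop : Continuous fun s => l * Real.exp (l * s) * f s).integral_hasStrictDerivAt
      0 t).hasDerivAt
  rw [funext (expFilter_eq_exp_mul l f)]
  refine ((hasDerivAt_exp_neg_mul l t).mul hint).congr_deriv ?_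
  have hinv : Real.exp (-(l * t)) * Real.exp (l * t) = 1 := by
    rw [← Real.exp_add, neg_add_cancel, Real.exp_zero]
  linear_combination l * f t * hinv

lemma continuous_expFilter : Continuous (expFilter l f) :=
  continuous_iff_continuousAt.2 fun t => (hasDerivAt_expFilter l hf t).continuousAt

lemma exists_forall_abs_le_of_tendsto_atTop {c : ℝ} (hlim : Tendsto f atTop (𝓝 c)) (a : ℝ) :
    ∃ C, ∀ t, a ≤ t → |f t| ≤ C := by
  obtain ⟨N, hN⟩ := eventually_atTop.1 (hlim.abs.eventually_le_const (lt_add_one |c|))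
  obtain ⟨C, hC⟩ := isCompact_Icc.exists_bound_of_continuousOn (s := Set.Icc a N) hf.continuousOn
  refine ⟨max C (|c| + 1), fun t ht => ?_⟩
  rcases le_total t N with h | h
  · exact le_max_of_le_left (hC t ⟨ht, h⟩)
  · exact le_max_of_le_right (hN t h)

variable {l}

lemma tendsto_expFilter (hl : 0 < l) {c : ℝ} (hlim : Tendsto f atTop (𝓝 c)) :
    Tendsto (expFilter l f) atTop (𝓝 c) := by
  have := isProbabilityMeasure_expMeasure hl
  obtain ⟨C, hC⟩ := exists_forall_abs_le_of_tendsto_atTop hf hlim 0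
  have hC0 : 0 ≤ C := (abs_nonneg _).trans (hC 0 le_rfl)
  have hbound (t u : ℝ) : ‖(Set.Iic t).indicator (fun u => f (t - u)) u‖ ≤ C := by
    by_cases hu : u ≤ t
    · rw [Set.indicator_of_mem (Set.mem_Iic.2 hu)]
      exact hC _ (sub_nonneg.2 hu)
    · rwa [Set.indicator_of_notMem (mt Set.mem_Iic.1 hu), norm_zero]
  have hpointwise (u : ℝ) :
      Tendsto (fun t => (Set.Iic t).indicator (fun u => f (t - u)) u) atTop (𝓝 c) := by
    refine (hlim.comp (tendsto_atTop_add_const_right _ (-u) tendsto_id)).congr' ?_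
    filter_upwards [eventually_ge_atTop u] with t ht
    rw [Set.indicator_of_mem (Set.mem_Iic.2 ht), Function.comp_apply, id, sub_eq_add_neg]
  have hdct := tendsto_integral_filter_of_dominated_convergence (μ := expMeasure l) (fun _ => C)
    (Eventually.of_forall fun t => ((by fun_prop : Measurable fun u => f (t - u)).indicator
      measurableSet_Iic).aestronglyMeasurable)
    (Eventually.of_forall fun t => Eventually.of_forall (hbound t)) (integrable_const C)
    (Eventually.of_forall hpointwise)
  rw [integral_const, probReal_univ, one_smul] at hdct
  exact hdct.congr' ((eventually_ge_atTop 0).mono fun t ht =>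
    (expFilter_eq_integral_expMeasure hl ht f).symm)

end

/-! ### Completion times -/

/-- The probability that `k` phases are completed within time `τ` from the start of step `q`. -/
noncomputable def completionProb (r : Fin 2 → ℝ) : ℕ → Fin 2 → ℝ → ℝ
  | 0, _ => fun _ => 1
  | k + 1, q => expFilter (r q) (completionProb r k (q + 1))

section

variable (r : Fin 2 → ℝ)

lemma completionProb_succ_zero (k : ℕ) (q : Fin 2) : completionProb r (k + 1) q 0 = 0 :=
  expFilter_zero _ _

lemma continuous_completionProb (k : ℕ) (q : Fin 2) : Continuous (completionProb r k q) := by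
  induction k generalizing q with
  | zero => exact continuous_const
  | succ k ih => exact continuous_expFilter _ (ih _)

lemma hasDerivAt_completionProb_succ (k : ℕ) (q : Fin 2) (τ : ℝ) :
    HasDerivAt (completionProb r (k + 1) q)
      (r q * (completionProb r k (q + 1) τ - completionProb r (k + 1) q τ)) τ :=
  hasDerivAt_expFilter _ (continuous_completionProb r k (q + 1)) τ

variable {r} (hr : ∀ q, 0 < r q)
include hr

lemma tendsto_completionProb (k : ℕ) (q : Fin 2) :
    Tendsto (completionProb r k q) atTop (𝓝 1) := by
  induction k generalizing q with
  | zero => exact tendsto_const_nhds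
  | succ k ih => exact tendsto_expFilter (continuous_completionProb r k _) (hr q) (ih _)

lemma integral_one_sub_completionProb_succ (k : ℕ) (q : Fin 2) (τ : ℝ) :
    ∫ s in (0 : ℝ)..τ, (1 - completionProb r (k + 1) q s) =
      (∫ s in (0 : ℝ)..τ, (1 - completionProb r k (q + 1) s)) +
        (r q)⁻¹ * completionProb r (k + 1) q τ := by
  have hcont := continuous_completionProb r
  have hderiv (s : ℝ) : HasDerivAt (fun s => (r q)⁻¹ * completionProb r (k + 1) q s)
      (completionProb r k (q + 1) s - completionProb r (k + 1) q s) s :=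
    ((hasDerivAt_completionProb_succ r k q s).const_mul _).congr_deriv
      (inv_mul_cancel_left₀ (hr q).ne' _)
  have hftc := intervalIntegral.integral_eq_sub_of_hasDerivAt (a := 0) (b := τ)
    (fun s _ => hderiv s) (Continuous.intervalIntegrable (by fun_prop) _ _)
  rw [completionProb_succ_zero, mul_zero, sub_zero] at hftc
  rw [← hftc, ← intervalIntegral.integral_add (Continuous.intervalIntegrable (by fun_prop) _ _)
    (Continuous.intervalIntegrable (by fun_prop) _ _)]
  congr 1 with s
  ring

lemma tendsto_integral_one_sub_completionProb (k : ℕ) (q : Fin 2) :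
    Tendsto (fun τ => ∫ s in (0 : ℝ)..τ, (1 - completionProb r k q s)) atTop
      (𝓝 (∑ i ∈ Finset.range k, (r (phaseStep q i))⁻¹)) := by
  induction k generalizing q with
  | zero => simp [completionProb]
  | succ k ih =>
    simp only [integral_one_sub_completionProb_succ hr, Finset.sum_range_succ', phaseStep_succ']
    simpa [phaseStep] using (ih (q + 1)).add ((tendsto_completionProb hr (k + 1) q).const_mul _)

end

/-! ### The step in progress -/

/-- The long-run fraction of time that an alternating-step system with rates `r` spends in
step `k`. -/
noncomputable def stepFraction (r : Fin 2 → ℝ) (k : Fin 2) : ℝ := r (k + 1) / (r 0 + r 1)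

/-- The probability that step `k` is in progress a time `τ` after step `q` starts. -/
noncomputable def stepProb (r : Fin 2 → ℝ) (k q : Fin 2) (τ : ℝ) : ℝ :=
  stepFraction r k + Real.exp (-((r 0 + r 1) * τ)) * ((if q = k then 1 else 0) - stepFraction r k)

lemma stepProb_zero (r : Fin 2 → ℝ) (k q : Fin 2) :
    stepProb r k q 0 = if q = k then 1 else 0 := by
  simp [stepProb]

section

variable {r : Fin 2 → ℝ} (hr : ∀ q, 0 < r q)
include hr

lemma stepFraction_succ_mul (q : Fin 2) : stepFraction r (q + 1) * (r 0 + r 1) = r q := by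
  rw [stepFraction, div_mul_cancel₀ _ (add_pos (hr 0) (hr 1)).ne', add_assoc]
  simp

lemma stepFraction_add_succ (q : Fin 2) : stepFraction r q + stepFraction r (q + 1) = 1 := by
  rw [stepFraction, stepFraction, ← add_div, div_eq_one_iff_eq (add_pos (hr 0) (hr 1)).ne']
  fin_cases q <;> simp [add_comm]

lemma hasDerivAt_stepProb (k q : Fin 2) (τ : ℝ) :
    HasDerivAt (stepProb r k q) (r q * (stepProb r k (q + 1) τ - stepProb r k q τ)) τ := by
  refine (((hasDerivAt_exp_neg_mul (r 0 + r 1) τ).mul_const _).const_add _).congr_deriv ?_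
  have hjump : (r 0 + r 1) * ((if q = k then 1 else 0) - stepFraction r k) =
      r q * ((if q = k then 1 else 0) - if q + 1 = k then 1 else 0) := by
    rw [stepFraction, mul_sub, mul_div_cancel₀ _ (add_pos (hr 0) (hr 1)).ne']
    fin_cases q <;> fin_cases k <;> simp
  simp only [stepProb]
  linear_combination -Real.exp (-((r 0 + r 1) * τ)) * hjump

lemma isBackwardSolution_stepProb (k : Fin 2) :
    IsBackwardSolution r fun q τ _ => stepProb r k q τ where
  continuous q := by unfold stepProb; fun_prop
  hasDerivAt q τ _ s :=
    ((hasDerivAt_stepProb hr k q (τ - s)).comp_const_sub τ s).congr_deriv (by ring)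

lemma tendsto_stepProb (k q : Fin 2) : Tendsto (stepProb r k q) atTop (𝓝 (stepFraction r k)) := by
  have hexp : Tendsto (fun τ => Real.exp (-((r 0 + r 1) * τ))) atTop (𝓝 0) :=
    Real.tendsto_exp_neg_atTop_nhds_zero.comp
      (tendsto_id.const_mul_atTop (add_pos (hr 0) (hr 1)))
  simpa only [stepProb, zero_mul, add_zero] using! (hexp.mul_const _).const_add (stepFraction r k)

end

/-! ### Accumulated rewards -/

/-- The expected reward accumulated within time `τ` from the start of step `q`, when step `k` earns
at rate `g k s` with time `s` left. The first term is the reward when the steps are in equilibrium,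
the second one corrects for the initial step. -/
noncomputable def expectedReward (r : Fin 2 → ℝ) (g : Fin 2 → ℝ → ℝ) (q : Fin 2) (τ : ℝ) : ℝ :=
  (∫ s in (0 : ℝ)..τ, ∑ k, stepFraction r k * g k s) +
    stepFraction r (q + 1) *
      expFilter (r 0 + r 1) (fun s => (g q s - g (q + 1) s) / (r 0 + r 1)) τ

lemma expectedReward_zero (r : Fin 2 → ℝ) (g : Fin 2 → ℝ → ℝ) (q : Fin 2) :
    expectedReward r g q 0 = 0 := by
  rw [expectedReward, expFilter_zero, intervalIntegral.integral_same, mul_zero, add_zero]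

section

variable {r : Fin 2 → ℝ} (hr : ∀ q, 0 < r q) {g : Fin 2 → ℝ → ℝ} (hg : ∀ k, Continuous (g k))
include hr hg

lemma hasDerivAt_expectedReward (q : Fin 2) (τ : ℝ) :
    HasDerivAt (expectedReward r g q)
      (g q τ + r q * (expectedReward r g (q + 1) τ - expectedReward r g q τ)) τ := by
  have hL : r 0 + r 1 ≠ 0 := (add_pos (hr 0) (hr 1)).ne'
  let w := fun q : Fin 2 =>
    expFilter (r 0 + r 1) (fun s => (g q s - g (q + 1) s) / (r 0 + r 1))
  have hqq : q + 1 + 1 = q := by fin_cases q <;> rfl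
  have hw_succ : w (q + 1) τ = -w q τ := by
    simp only [w, hqq, ← expFilter_neg]
    congr 1 with s
    rw [Pi.neg_apply, ← neg_div, neg_sub]
  have hdiff : expectedReward r g (q + 1) τ - expectedReward r g q τ = -w q τ := by
    calc expectedReward r g (q + 1) τ - expectedReward r g q τ
        = stepFraction r q * w (q + 1) τ - stepFraction r (q + 1) * w q τ := by
          simp only [expectedReward, hqq, w, add_sub_add_left_eq_sub]
      _ = -w q τ := by
          rw [hw_succ]
          linear_combination -w q τ * stepFraction_add_succ hr q
  have hint : HasDerivAt (fun τ => ∫ s in (0 : ℝ)..τ, ∑ k, stepFraction r k * g k s)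
      (∑ k, stepFraction r k * g k τ) τ :=
    ((by fun_prop : Continuous fun s => ∑ k, stepFraction r k * g k s).integral_hasStrictDerivAt
      0 τ).hasDerivAt
  have hsum : ∑ k, stepFraction r k * g k τ =
      stepFraction r q * g q τ + stepFraction r (q + 1) * g (q + 1) τ := by
    fin_cases q <;> simp [Fin.sum_univ_two, add_comm]
  refine (hint.add ((hasDerivAt_expFilter (r 0 + r 1) (by fun_prop) τ).const_mul
    (stepFraction r (q + 1)))).congr_deriv ?_
  rw [hsum, hdiff, mul_sub (r 0 + r 1), mul_div_cancel₀ _ hL]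
  linear_combination g q τ * stepFraction_add_succ hr q - w q τ * stepFraction_succ_mul hr q

lemma continuous_expectedReward (q : Fin 2) : Continuous (expectedReward r g q) :=
  continuous_iff_continuousAt.2 fun τ => (hasDerivAt_expectedReward hr hg q τ).continuousAt

lemma tendsto_expectedReward (hg_lim : ∀ k, Tendsto (g k) atTop (𝓝 0)) {I : Fin 2 → ℝ}
    (hI : ∀ k, Tendsto (fun τ => ∫ s in (0 : ℝ)..τ, g k s) atTop (𝓝 (I k))) (q : Fin 2) :
    Tendsto (expectedReward r g q) atTop (𝓝 (∑ k, stepFraction r k * I k)) := by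
  have hint (τ : ℝ) : ∫ s in (0 : ℝ)..τ, ∑ k, stepFraction r k * g k s =
      ∑ k, stepFraction r k * ∫ s in (0 : ℝ)..τ, g k s := by
    rw [intervalIntegral.integral_finsetSum fun k _ => ((hg k).const_mul _).intervalIntegrable _ _]
    simp only [intervalIntegral.integral_const_mul]
  have hcorr : Tendsto (expFilter (r 0 + r 1) fun s => (g q s - g (q + 1) s) / (r 0 + r 1))
      atTop (𝓝 0) := by
    refine tendsto_expFilter (by fun_prop) (add_pos (hr 0) (hr 1)) ?_
    simpa only [sub_zero, zero_div] using ((hg_lim q).sub (hg_lim (q + 1))).div_const (r 0 + r 1)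
  have := (tendsto_finsetSum Finset.univ fun k _ => (hI k).const_mul (stepFraction r k)).add
    (hcorr.const_mul (stepFraction r (q + 1)))
  rw [mul_zero, add_zero] at this
  exact this.congr fun τ => by rw [expectedReward, hint]

end

/-! ### The expected age at the monitor -/

/-- The number of phases, starting with step `q`, up to the next delivery. -/
def phasesToDelivery : Fin 2 → ℕ := ![2, 1]

/-- The expected age at the monitor a time `τ` after step `q` starts with ages `x`. The coefficients
of `x 0` and `x 1` are the probabilities of no delivery and of exactly one within that time. -/
noncomputable def expectedAge (r : Fin 2 → ℝ) (q : Fin 2) (τ : ℝ) (x : Fin 2 → ℝ) : ℝ :=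
  expectedReward r (fun k s => 1 - completionProb r (phasesToDelivery k + 2) k s) q τ +
    (1 - completionProb r (phasesToDelivery q) q τ) * x 0 +
    (completionProb r (phasesToDelivery q) q τ -
      completionProb r (phasesToDelivery q + 2) q τ) * x 1

lemma expectedAge_zero (r : Fin 2 → ℝ) (q : Fin 2) (x : Fin 2 → ℝ) :
    expectedAge r q 0 x = x 0 := by
  have hpos : phasesToDelivery q = phasesToDelivery q - 1 + 1 := by fin_cases q <;> rfl
  rw [expectedAge, hpos, expectedReward_zero, completionProb_succ_zero, add_right_comm _ 1 2,
    completionProb_succ_zero]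
  ring

section

variable {r : Fin 2 → ℝ} (hr : ∀ q, 0 < r q)
include hr

lemma isBackwardSolution_expectedAge : IsBackwardSolution r (expectedAge r) where
  continuous q := by
    have := continuous_completionProb r
    have := continuous_expectedReward hr
      (g := fun k s => 1 - completionProb r (phasesToDelivery k + 2) k s) (by fun_prop)
    unfold expectedAge
    fun_prop
  hasDerivAt q τ x s := by
    have hG := continuous_completionProb r
    have hreward := (hasDerivAt_expectedReward hr
      (g := fun k s => 1 - completionProb r (phasesToDelivery k + 2) k s) (by fun_prop) q
      (τ - s)).comp_const_sub τ s
    have hcompletion (k : ℕ) :=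
      (hasDerivAt_completionProb_succ r k q (τ - s)).comp_const_sub τ s
    have hage (j : Fin 2) : HasDerivAt (fun s => x j + s) 1 s := (hasDerivAt_id s).const_add (x j)
    fin_cases q
    · refine ((hreward.add (((hcompletion 1).const_sub 1).mul (hage 0))).add
        (((hcompletion 1).sub (hcompletion 3)).mul (hage 1))).congr_deriv ?_
      simp only [expectedAge, completeStep, phasesToDelivery, Pi.sub_apply, Fin.zero_eta,
        Fin.isValue, Matrix.cons_val_zero, Matrix.cons_val_one, Nat.reduceAdd, zero_add, if_true]
      ring
    · refine ((hreward.add (((hcompletion 0).const_sub 1).mul (hage 0))).add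
        (((hcompletion 0).sub (hcompletion 2)).mul (hage 1))).congr_deriv ?_
      simp only [expectedAge, completeStep, phasesToDelivery, completionProb, Pi.sub_apply,
        Fin.mk_one, Fin.isValue, Fin.reduceAdd, Matrix.cons_val_zero, Matrix.cons_val_one,
        zero_add, one_ne_zero, if_false]
      ring

lemma tendsto_expectedAge (q : Fin 2) (x : Fin 2 → ℝ) :
    Tendsto (fun τ => expectedAge r q τ x) atTop
      (𝓝 (2 / r 1 + 1 / r 0 + r 1 / (r 0 * (r 0 + r 1)))) := by
  have hG := tendsto_completionProb hr
  have hreward := tendsto_expectedReward hr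
    (g := fun k s => 1 - completionProb r (phasesToDelivery k + 2) k s)
    (fun k => continuous_const.sub (continuous_completionProb r _ k))
    (fun k => by simpa using (hG (phasesToDelivery k + 2) k).const_sub 1)
    (fun k => tendsto_integral_one_sub_completionProb hr (phasesToDelivery k + 2) k) q
  have hlim := (hreward.add (((hG (phasesToDelivery q) q).const_sub 1).mul_const (x 0))).add
    (((hG (phasesToDelivery q) q).sub (hG (phasesToDelivery q + 2) q)).mul_const (x 1))
  have hvalue : ∑ k, stepFraction r k * ∑ i ∈ Finset.range (phasesToDelivery k + 2),
      (r (phaseStep k i))⁻¹ = 2 / r 1 + 1 / r 0 + r 1 / (r 0 * (r 0 + r 1)) := by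
    have h0 := (hr 0).ne'
    have h1 := (hr 1).ne'
    have hL := (add_pos (hr 0) (hr 1)).ne'
    simp only [phasesToDelivery, stepFraction, phaseStep, Fin.sum_univ_two, Finset.sum_range_succ,
      Finset.range_zero, Finset.sum_empty, Matrix.cons_val_zero, Matrix.cons_val_one, zero_add,
      Fin.isValue, Fin.reduceAdd]
    field_simp
    ring
  simpa only [hvalue, sub_self, zero_mul, add_zero] using! hlim

end

namespace IsExpStepDurations

variable {Ω : Type*} [MeasurableSpace Ω] {P : Measure Ω} [IsProbabilityMeasure P] {r : Fin 2 → ℝ}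
  {q₀ : Fin 2} {D : ℕ → Ω → ℝ} (h : IsExpStepDurations P r q₀ D) (hr : ∀ q, 0 < r q)
include h hr

lemma measureReal_stateAt_eq {t : ℝ} (ht : 0 ≤ t) (k : Fin 2) :
    P.real {ω | stateAt q₀ (D · ω) t = k} = stepProb r k q₀ t := by
  obtain ⟨hint, heq⟩ :=
    h.integrable_and_integral_eq hr (isBackwardSolution_stepProb hr k) ht 0
  have hindicator : (fun ω => stepProb r k (stateAt q₀ (D · ω) t) 0) =
      {ω | stateAt q₀ (D · ω) t = k}.indicator 1 := by
    ext ω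
    simp only [stepProb_zero, Set.indicator_apply, Set.mem_ofPred_eq, Pi.one_apply]
  rw [hindicator] at hint heq
  have hmeas : NullMeasurableSet {ω | stateAt q₀ (D · ω) t = k} P :=
    (aemeasurable_indicator_const_iff 1).1 hint.aemeasurable
  simp [← heq, integral_indicator₀ hmeas]

lemma tendsto_measureReal_stateAt_eq (k : Fin 2) :
    Tendsto (fun t => P.real {ω | stateAt q₀ (D · ω) t = k}) atTop (𝓝 (stepFraction r k)) :=
  (tendsto_stepProb hr k q₀).congr' <| (eventually_ge_atTop 0).mono fun _ ht =>
    (h.measureReal_stateAt_eq hr ht k).symm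

lemma integrable_agesAt_zero {t : ℝ} (ht : 0 ≤ t) (a : Fin 2 → ℝ) :
    Integrable (fun ω => agesAt q₀ a (D · ω) t 0) P := by
  simpa only [expectedAge_zero] using
    (h.integrable_and_integral_eq hr (isBackwardSolution_expectedAge hr) ht a).1

lemma integral_agesAt_zero {t : ℝ} (ht : 0 ≤ t) (a : Fin 2 → ℝ) :
    ∫ ω, agesAt q₀ a (D · ω) t 0 ∂P = expectedAge r q₀ t a := by
  simpa only [expectedAge_zero] using
    (h.integrable_and_integral_eq hr (isBackwardSolution_expectedAge hr) ht a).2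

lemma tendsto_integral_agesAt_zero (a : Fin 2 → ℝ) :
    Tendsto (fun t => ∫ ω, agesAt q₀ a (D · ω) t 0 ∂P) atTop
      (𝓝 (2 / r 1 + 1 / r 0 + r 1 / (r 0 * (r 0 + r 1)))) :=
  (tendsto_expectedAge hr q₀ a).congr' <| (eventually_ge_atTop 0).mono fun _ ht =>
    (h.integral_agesAt_zero hr ht a).symm

end IsExpStepDurations

/-! ### The P-SIU system -/

lemma IsPSIUExecutionTimes.isExpStepDurations {Ω : Type*} [MeasurableSpace Ω] {P : Measure Ω}
    [IsProbabilityMeasure P] {μ₁ μ₂ : ℝ} {q₀ : Fin 2} {T : ℕ → Fin 2 → Ω → ℝ}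
    (hT : IsPSIUExecutionTimes P μ₁ μ₂ q₀ T) (hμ₁ : 0 < μ₁) (hμ₂ : 0 < μ₂) :
    IsExpStepDurations P ![2 * μ₁, 2 * μ₂] q₀ fun n ω => psiuDuration T ω n where
  measurable n := (hT.measurable n 0).min (hT.measurable n 1)
  indep := (iIndepFun_curry hT.measurable hT.indep).comp (fun _ x => min (x 0) (x 1)) fun _ => by
    fun_prop
  law n := by
    have hpos (q : Fin 2) : 0 < ![μ₁, μ₂] q := by fin_cases q <;> simpa
    have hrate (q : Fin 2) : ![2 * μ₁, 2 * μ₂] q = ![μ₁, μ₂] q + ![μ₁, μ₂] q := by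
      fin_cases q <;> simp [two_mul]
    rw [hrate]
    exact hasLaw_min_expMeasure (hpos _) (hpos _) (hT.law n 0) (hT.law n 1)
      (hT.indep.indepFun (i := (n, 0)) (j := (n, 1)) (by simp))

lemma pwpa_psiuNumWorking (α ρ : ℝ) (π : Fin 2 → ℝ) :
    pwpa α ρ π psiuNumWorking = 2 * (ρ ^ α * π 0 + π 1) := by
  have hnum : ∀ q i, psiuNumWorking q i = if q = i then 2 else 0 := by decide
  simp only [pwpa, avgWorking, hnum, Fin.sum_univ_two, Fin.isValue, one_ne_zero, zero_ne_one,
    if_true, if_false, Nat.cast_zero, Nat.cast_ofNat, mul_zero, add_zero, zero_add]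
  ring

lemma IsPSIUExecutionTimes.tendsto_integral_agesAt_zero {Ω : Type*} [MeasurableSpace Ω]
    {P : Measure Ω} [IsProbabilityMeasure P] {μ₁ μ₂ : ℝ} {q₀ : Fin 2} {T : ℕ → Fin 2 → Ω → ℝ}
    (hT : IsPSIUExecutionTimes P μ₁ μ₂ q₀ T) (hμ₁ : 0 < μ₁) (hμ₂ : 0 < μ₂) (a : Fin 2 → ℝ) :
    Tendsto (fun t => ∫ ω, agesAt q₀ a (psiuDuration T ω) t 0 ∂P) atTop
      (𝓝 (1 / μ₂ * (1 + 1 / (2 * (μ₁ / μ₂)) * (1 + 1 / (1 + μ₁ / μ₂))))) := by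
  have hr : ∀ q, 0 < ![2 * μ₁, 2 * μ₂] q := by simp [Fin.forall_fin_two, hμ₁, hμ₂]
  convert (hT.isExpStepDurations hμ₁ hμ₂).tendsto_integral_agesAt_zero hr a using 2
  simp only [Matrix.cons_val_zero, Matrix.cons_val_one]
  field_simp
  ring

/-- The solution of the age balance equations of P-SIU for the distribution `π` of the step in
progress. -/
noncomputable def balancedAges (μ₁ μ₂ : ℝ) (π : Fin 2 → ℝ) : Fin 2 → Fin 2 → ℝ :=
  ![![(2 * π 0 + π 1) / (2 * μ₁), π 0 / (2 * μ₁)],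
    ![2 * (π 0 + π 1) / (2 * μ₂), (π 0 + π 1) / (2 * μ₂)]]

section

variable {μ₁ μ₂ : ℝ} (hμ₁ : 0 < μ₁) (hμ₂ : 0 < μ₂)
include hμ₁ hμ₂

lemma psiuSHS_isStationary_iff (π : Fin 2 → ℝ) :
    (psiuSHS μ₁ μ₂).IsStationary π ↔ π = stepFraction ![2 * μ₁, 2 * μ₂] := by
  have hiff : (psiuSHS μ₁ μ₂).IsStationary π ↔
      (0 ≤ π 0 ∧ 0 ≤ π 1) ∧ π 0 + π 1 = 1 ∧ π 0 * (2 * μ₁) = 2 * μ₂ * π 1 ∧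
        π 1 * (2 * μ₂) = 2 * μ₁ * π 0 := by
    simp [AgeSHS.IsStationary, psiuSHS, Fin.sum_univ_two, Fin.forall_fin_two]
  have hfraction : π = stepFraction ![2 * μ₁, 2 * μ₂] ↔
      π 0 = 2 * μ₂ / (2 * μ₁ + 2 * μ₂) ∧ π 1 = 2 * μ₁ / (2 * μ₁ + 2 * μ₂) := by
    simp [funext_iff, Fin.forall_fin_two, stepFraction]
  rw [hiff, hfraction]
  constructor
  · rintro ⟨-, hsum, hflow, -⟩
    rw [eq_div_iff (by positivity), eq_div_iff (by positivity)]
    exact ⟨by linear_combination hflow + 2 * μ₂ * hsum,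
      by linear_combination -hflow + 2 * μ₁ * hsum⟩
  · rintro ⟨h0, h1⟩
    rw [h0, h1]
    refine ⟨⟨by positivity, by positivity⟩, ?_, ?_, ?_⟩ <;> field_simp
    exact add_comm _ _

lemma stepFraction_two_mul_zero : stepFraction ![2 * μ₁, 2 * μ₂] 0 = 1 / (1 + μ₁ / μ₂) := by
  simp only [stepFraction, zero_add, Matrix.cons_val_zero, Matrix.cons_val_one]
  field_simp
  ring

lemma stepFraction_two_mul_one :
    stepFraction ![2 * μ₁, 2 * μ₂] 1 = μ₁ / μ₂ / (1 + μ₁ / μ₂) := by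
  simp only [stepFraction, Fin.isValue, Fin.reduceAdd, Matrix.cons_val_zero, Matrix.cons_val_one]
  field_simp
  ring

lemma psiuSHS_ageBalance_iff (π : Fin 2 → ℝ) (v : Fin 2 → Fin 2 → ℝ) :
    (psiuSHS μ₁ μ₂).AgeBalance π v ↔ v = balancedAges μ₁ μ₂ π := by
  have hiff : (psiuSHS μ₁ μ₂).AgeBalance π v ↔
      ((2 * μ₁ * v 0 0 = π 0 + 2 * μ₂ * v 1 1 ∧ 2 * μ₁ * v 0 1 = π 0) ∧
        2 * μ₂ * v 1 0 = π 1 + 2 * μ₁ * v 0 0 ∧ 2 * μ₂ * v 1 1 = π 1 + 2 * μ₁ * v 0 1) := by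
    simp [AgeSHS.AgeBalance, psiuSHS, Matrix.vecHead, Matrix.vecTail, Fin.sum_univ_two,
      Fin.forall_fin_two, funext_iff]
  have hbalanced : v = balancedAges μ₁ μ₂ π ↔
      (v 0 0 = (2 * π 0 + π 1) / (2 * μ₁) ∧ v 0 1 = π 0 / (2 * μ₁)) ∧
        v 1 0 = 2 * (π 0 + π 1) / (2 * μ₂) ∧ v 1 1 = (π 0 + π 1) / (2 * μ₂) := by
    simp [balancedAges, funext_iff, Fin.forall_fin_two]
  rw [hiff, hbalanced]
  simp only [eq_div_iff (mul_pos two_pos hμ₁).ne', eq_div_iff (mul_pos two_pos hμ₂).ne']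
  constructor <;> rintro ⟨⟨h00, h01⟩, h10, h11⟩ <;> refine ⟨⟨?_, ?_⟩, ?_, ?_⟩ <;> linarith

lemma balancedAges_nonneg {π : Fin 2 → ℝ} (hπ : ∀ q, 0 ≤ π q) (q j : Fin 2) :
    0 ≤ balancedAges μ₁ μ₂ π q j := by
  have := hπ 0
  have := hπ 1
  fin_cases q <;> fin_cases j <;> simp only [balancedAges, Fin.isValue, Fin.zero_eta, Fin.mk_one,
    Matrix.cons_val', Matrix.cons_val_zero, Matrix.cons_val_one, Matrix.cons_val_fin_one] <;>
    positivity

lemma balancedAges_stepFraction_sum :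
    balancedAges μ₁ μ₂ (stepFraction ![2 * μ₁, 2 * μ₂]) 0 0 +
        balancedAges μ₁ μ₂ (stepFraction ![2 * μ₁, 2 * μ₂]) 1 0 =
      1 / μ₂ * (1 + 1 / (2 * (μ₁ / μ₂)) * (1 + 1 / (1 + μ₁ / μ₂))) := by
  simp only [balancedAges, stepFraction, Fin.isValue, Fin.reduceAdd, zero_add, Matrix.cons_val',
    Matrix.cons_val_zero, Matrix.cons_val_one, Matrix.cons_val_fin_one]
  field_simp
  ring

end


theorem mainTheorem4 {Ω : Type*} [MeasurableSpace Ω] (P : Measure Ω) [IsProbabilityMeasure P]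
    (μ₁ μ₂ ρ α : ℝ) (hμ₁ : 0 < μ₁) (hμ₂ : 0 < μ₂) (hρ : ρ = μ₁ / μ₂)
    (q₀ : Fin 2) (a : Fin 2 → ℝ) (ha : ∀ j, 0 ≤ a j)
    (T : ℕ → Fin 2 → Ω → ℝ) (hT : IsPSIUExecutionTimes P μ₁ μ₂ q₀ T) :
    -- the system acts like one server with independent exponential steps of rates `2μ₁`, `2μ₂`
    (iIndepFun (fun n ω => psiuDuration T ω n) P ∧
      ∀ n, HasLaw (fun ω => psiuDuration T ω n)
        (expMeasure (![2 * μ₁, 2 * μ₂] (phaseStep q₀ n))) P) ∧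
    -- the average age at the monitor, as the limit of the expected age
    ((∀ t : ℝ, 0 ≤ t → Integrable (fun ω => agesAt q₀ a (psiuDuration T ω) t 0) P) ∧
      Tendsto (fun t : ℝ => ∫ ω, agesAt q₀ a (psiuDuration T ω) t 0 ∂P) atTop
        (𝓝 (1 / μ₂ * (1 + 1 / (2 * ρ) * (1 + 1 / (1 + ρ)))))) ∧
    -- the stationary probabilities, the processor activity and the age balance equations
    ∃ π : Fin 2 → ℝ,
      (∀ π' : Fin 2 → ℝ, (psiuSHS μ₁ μ₂).IsStationary π' ↔ π' = π) ∧
      π 0 = 1 / (1 + ρ) ∧ π 1 = ρ / (1 + ρ) ∧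
      (∀ q, Tendsto (fun t : ℝ => P.real {ω | stateAt q₀ (psiuDuration T ω) t = q}) atTop
        (𝓝 (π q))) ∧
      pwpa α ρ π psiuNumWorking = 2 * (ρ ^ α + ρ) / (1 + ρ) ∧
      ∃ v : Fin 2 → Fin 2 → ℝ,
        (∀ v' : Fin 2 → Fin 2 → ℝ, (psiuSHS μ₁ μ₂).AgeBalance π v' ↔ v' = v) ∧
        (∀ q j, 0 ≤ v q j) ∧
        v 0 0 + v 1 0 = 1 / μ₂ * (1 + 1 / (2 * ρ) * (1 + 1 / (1 + ρ))) := by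
  subst hρ
  have hr : ∀ q, 0 < ![2 * μ₁, 2 * μ₂] q := by simp [Fin.forall_fin_two, hμ₁, hμ₂]
  have hD := hT.isExpStepDurations hμ₁ hμ₂
  have h0 := stepFraction_two_mul_zero hμ₁ hμ₂
  have h1 := stepFraction_two_mul_one hμ₁ hμ₂
  have hπ := ((psiuSHS_isStationary_iff hμ₁ hμ₂ _).2 rfl).1
  refine ⟨⟨hD.indep, hD.law⟩,
    ⟨fun t ht => hD.integrable_agesAt_zero hr ht a, hT.tendsto_integral_agesAt_zero hμ₁ hμ₂ a⟩,
    stepFraction ![2 * μ₁, 2 * μ₂], psiuSHS_isStationary_iff hμ₁ hμ₂, h0, h1,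
    hD.tendsto_measureReal_stateAt_eq hr, ?_,
    balancedAges μ₁ μ₂ _, psiuSHS_ageBalance_iff hμ₁ hμ₂ _, balancedAges_nonneg hμ₁ hμ₂ hπ,
    balancedAges_stepFraction_sum hμ₁ hμ₂⟩
  rw [pwpa_psiuNumWorking, h0, h1]
  ring
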